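/- For a finite semigroup $T$, let $l(T)$ be the largest number of non-empty subsemigroups of $T$ in a chain (under inclusion), minus $1$. A semigroup is inverse if for every element $x$ there is a unique $y$ with $xyx=x$ and $yxy=y$; for a finite inverse semigroup $T$, let $l^*(T)$ be the largest number of non-empty inverse subsemigroups of $T$ in a chain, minus $1$ (an inverse subsemigroup is a subsemigroup that is itself an inverse semigroup). For a group $G$ and $n\ge 1$, the Brandt semigroup $B(G,n)$ has elements $(\{1,\dots,n\}\times G\times\{1,\dots,n\})\cup\{0\}$ with $(i,g,j)(k,h,l)=(i,gh,l)$ if $j=k$, and all other products equal to $0$. **Theorem.** Let $S$ be a finite inverse semigroup with $\mathscr{J}$-classes $J_1,\dots,J_m$. For each $i$, the number of $\mathscr{L}$-classes in $J_i$ equals the number of $\mathscr{R}$-classes in $J_i$; denote this number by $n_i$, and let $G_i$ be any maximal subgroup of $S$ contained in $J_i$. Then $$l^*(S) = -1+\sum_{i=1}^m l^*(B(G_i,n_i)) = -1+\sum_{i=1}^m \bigl[n_i(l(G_i)+1)+n_i-1\bigr].$$ -/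

import Mathlib

/-- A semigroup is inverse if every `x` has exactly one `y` with `x y x = x` and `y x y = y`. -/
def IsInverseSemigroup (S : Type*) [Semigroup S] : Prop :=
  ∀ x : S, ∃! y : S, x * y * x = x ∧ y * x * y = y

/-- `k` is the number of members of some finite chain (with respect to inclusion) of non-empty
subsemigroups of `S`. -/
def IsSubsemigroupChainCard (S : Type*) [Semigroup S] (k : ℕ) : Prop :=
  ∃ C : Finset (Subsemigroup S), IsChain (· ≤ ·) (C : Set (Subsemigroup S)) ∧
    (∀ T ∈ C, (T : Set S).Nonempty) ∧ C.card = k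

/-- `k` is the number of members of some finite chain (with respect to inclusion) of non-empty
inverse subsemigroups of `S`, that is, of non-empty subsemigroups that are themselves inverse
semigroups. -/
def IsInverseSubsemigroupChainCard (S : Type*) [Semigroup S] (k : ℕ) : Prop :=
  ∃ C : Finset (Subsemigroup S), IsChain (· ≤ ·) (C : Set (Subsemigroup S)) ∧
    (∀ T ∈ C, (T : Set S).Nonempty ∧ IsInverseSemigroup T) ∧ C.card = k

/-- The length `l(S)`: the largest number of non-empty subsemigroups of `S` in a chain, minus `1`.
It is used for finite `S`, where the maximum exists (`isGreatest_subsemigroupLength`). -/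
noncomputable def subsemigroupLength (S : Type*) [Semigroup S] : ℤ :=
  (sSup {k : ℕ | IsSubsemigroupChainCard S k} : ℕ) - 1

/-- The inverse subsemigroup length `l*(S)`: the largest number of non-empty inverse subsemigroups
of `S` in a chain, minus `1`.  It is used for finite `S`, where the maximum exists
(`isGreatest_inverseSubsemigroupLength`). -/
noncomputable def inverseSubsemigroupLength (S : Type*) [Semigroup S] : ℤ :=
  (sSup {k : ℕ | IsInverseSubsemigroupChainCard S k} : ℕ) - 1

theorem isGreatest_subsemigroupLength (S : Type*) [Semigroup S] [Finite S] :
    IsGreatest {z : ℤ | ∃ k : ℕ, IsSubsemigroupChainCard S k ∧ z = k - 1}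
      (subsemigroupLength S) := by
  have hb : BddAbove {k : ℕ | IsSubsemigroupChainCard S k} := by
    refine ⟨Nat.card (Subsemigroup S), ?_⟩
    rintro k ⟨C, -, -, rfl⟩
    have : Finite (Subsemigroup S) :=
      Finite.of_injective (fun T : Subsemigroup S => (T : Set S)) SetLike.coe_injective
    simpa using Set.ncard_le_card (C : Set (Subsemigroup S))
  have hn : {k : ℕ | IsSubsemigroupChainCard S k}.Nonempty := ⟨0, ∅, by simp, by simp, rfl⟩
  refine ⟨⟨_, Nat.sSup_mem hn hb, rfl⟩, ?_⟩
  rintro z ⟨k, hk, rfl⟩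
  have := le_csSup hb hk
  unfold subsemigroupLength
  omega

theorem isGreatest_inverseSubsemigroupLength (S : Type*) [Semigroup S] [Finite S] :
    IsGreatest {z : ℤ | ∃ k : ℕ, IsInverseSubsemigroupChainCard S k ∧ z = k - 1}
      (inverseSubsemigroupLength S) := by
  have hb : BddAbove {k : ℕ | IsInverseSubsemigroupChainCard S k} := by
    refine ⟨Nat.card (Subsemigroup S), ?_⟩
    rintro k ⟨C, -, -, rfl⟩
    have : Finite (Subsemigroup S) :=
      Finite.of_injective (fun T : Subsemigroup S => (T : Set S)) SetLike.coe_injective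
    simpa using Set.ncard_le_card (C : Set (Subsemigroup S))
  have hn : {k : ℕ | IsInverseSubsemigroupChainCard S k}.Nonempty :=
    ⟨0, ∅, by simp, by simp, rfl⟩
  refine ⟨⟨_, Nat.sSup_mem hn hb, rfl⟩, ?_⟩
  rintro z ⟨k, hk, rfl⟩
  have := le_csSup hb hk
  unfold inverseSubsemigroupLength
  omega

/-- Green's relation `𝓛`: `S¹x = S¹y`, where `S¹` is `S` with an identity adjoined. -/
def greenL (S : Type*) [Semigroup S] : Setoid S :=
  Setoid.ker fun x : S => {z : S | ∃ a : WithOne S, (z : WithOne S) = a * x}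

/-- Green's relation `𝓡`: `xS¹ = yS¹`. -/
def greenR (S : Type*) [Semigroup S] : Setoid S :=
  Setoid.ker fun x : S => {z : S | ∃ b : WithOne S, (z : WithOne S) = x * b}

/-- Green's relation `𝓙`: `S¹xS¹ = S¹yS¹`. -/
def greenJ (S : Type*) [Semigroup S] : Setoid S :=
  Setoid.ker fun x : S => {z : S | ∃ a b : WithOne S, (z : WithOne S) = a * x * b}

/-- The number of `𝓛`-classes of `S` contained in the subset `J`. -/
noncomputable def numLClasses {S : Type*} [Semigroup S] (J : Set S) : ℕ :=
  {L : Set S | L ∈ (greenL S).classes ∧ L ⊆ J}.ncard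

/-- The number of `𝓡`-classes of `S` contained in the subset `J`. -/
noncomputable def numRClasses {S : Type*} [Semigroup S] (J : Set S) : ℕ :=
  {R : Set S | R ∈ (greenR S).classes ∧ R ⊆ J}.ncard

/-- The subsemigroup `H` of `S` is a group under the multiplication of `S`
(its identity need not be an identity of `S`). -/
def IsGroupSubsemigroup {S : Type*} [Semigroup S] (H : Subsemigroup S) : Prop :=
  ∃ e ∈ H, (∀ x ∈ H, e * x = x ∧ x * e = x) ∧ ∀ x ∈ H, ∃ y ∈ H, x * y = e ∧ y * x = e

/-- A maximal subgroup of the semigroup `S`: a subsemigroup that is a group, and that is maximal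
with respect to inclusion among such subsemigroups. -/
structure MaximalSubgroup (S : Type*) [Semigroup S] where
  toSubsemigroup : Subsemigroup S
  maximal : Maximal IsGroupSubsemigroup toSubsemigroup

/-- The group structure on a maximal subgroup; its multiplication is that of `S`. -/
noncomputable instance MaximalSubgroup.instGroup {S : Type*} [Semigroup S]
    (G : MaximalSubgroup S) : Group G.toSubsemigroup :=
  { (inferInstance : Semigroup G.toSubsemigroup) with
    one := ⟨G.maximal.prop.choose, G.maximal.prop.choose_spec.1⟩
    inv := fun x => ⟨(G.maximal.prop.choose_spec.2.2 x x.2).choose,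
      (G.maximal.prop.choose_spec.2.2 x x.2).choose_spec.1⟩
    one_mul := fun x => Subtype.ext (G.maximal.prop.choose_spec.2.1 x x.2).1
    mul_one := fun x => Subtype.ext (G.maximal.prop.choose_spec.2.1 x x.2).2
    inv_mul_cancel := fun x =>
      Subtype.ext (G.maximal.prop.choose_spec.2.2 x x.2).choose_spec.2.2 }

/-- The underlying set of the Brandt semigroup `B(G, n)`: triples `(i, g, j)` and a zero. -/
inductive BrandtSemigroup (G : Type*) (n : ℕ) where
  | zero : BrandtSemigroup G n
  | elem (i : Fin n) (g : G) (j : Fin n) : BrandtSemigroup G n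

/-- `(i, g, j)(k, h, l) = (i, gh, l)` if `j = k`, and all other products are zero. -/
def BrandtSemigroup.mul {G : Type*} [Group G] {n : ℕ} :
    BrandtSemigroup G n → BrandtSemigroup G n → BrandtSemigroup G n
  | .elem i g j, .elem k h l => if j = k then .elem i (g * h) l else .zero
  | _, _ => .zero

instance BrandtSemigroup.instSemigroup {G : Type*} [Group G] {n : ℕ} :
    Semigroup (BrandtSemigroup G n) where
  mul := BrandtSemigroup.mul
  mul_assoc := by
    intro a b c
    change BrandtSemigroup.mul (BrandtSemigroup.mul a b) c =
      BrandtSemigroup.mul a (BrandtSemigroup.mul b c)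
    rcases a with _ | ⟨i, g, j⟩ <;> rcases b with _ | ⟨k, h, l⟩ <;>
      rcases c with _ | ⟨p, q, r⟩ <;> simp only [BrandtSemigroup.mul] <;>
      split_ifs <;> simp_all [BrandtSemigroup.mul, mul_assoc]

/-! A finite inverse semigroup is treated as a groupoid: objects are the idempotents, an element `x`
is an arrow with ends `ran x` and `dom x`, and `groupAt e` is the vertex group at `e`. Write N for
the largest number of members of a chain, N = length + 1. Everything follows from one identity,
`inverseSubsemigroupChainNum_add_card_quotient`: N*(S) plus the number of connected components
equals the sum over idempotents `e` of N(`groupAt e`) + 1.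

Upper bound: an inverse subsemigroup is controlled by its vertex groups and by which idempotents it
links. `potential` adds the chain numbers of the former to the number of merges in the latter; it is
strictly increasing (`potential_strictMono`), which bounds every chain.

Lower bound: idempotents are adjoined in order of increasing rank. A new `e` contributes a longest
chain of its vertex group, and one further step when it is linked to an earlier idempotent
(`exists_chain_of_rankClosed`).

In the finite case components are the 𝓙-classes (`greenJ_idem_iff`), and both 𝓛- and 𝓡-classes in
`J` are counted by idempotents of `J`, so grouping the sum by 𝓙-class gives the formula in the n_i
and l(G_i). The same identity applied to a Brandt semigroup evaluates each summand. -/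

/-- A semigroup with an inverse operation, in which `x⁻¹` is the only generalized inverse of `x`. -/
class InverseSemigroup (S : Type*) extends Semigroup S, Inv S where
  mul_inv_mul_self : ∀ x : S, x * x⁻¹ * x = x
  inv_mul_inv_self : ∀ x : S, x⁻¹ * x * x⁻¹ = x⁻¹
  eq_inv : ∀ x y : S, x * y * x = x → y * x * y = y → y = x⁻¹

/-- The inverse operation of a semigroup with unique generalized inverses. -/
@[reducible]
noncomputable def IsInverseSemigroup.toInverseSemigroup {S : Type*} [Semigroup S]
    (h : IsInverseSemigroup S) : InverseSemigroup S :=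
  { (inferInstance : Semigroup S) with
    inv := fun x => (h x).choose
    mul_inv_mul_self := fun x => (h x).choose_spec.1.1
    inv_mul_inv_self := fun x => (h x).choose_spec.1.2
    eq_inv := fun x y h1 h2 => (h x).choose_spec.2 y ⟨h1, h2⟩ }

/-- The idempotents of a semigroup. -/
abbrev Idem (S : Type*) [Mul S] : Type _ := {e : S // e * e = e}

/-! ### Inverse semigroups: idempotents, ends of an element, rank, vertex groups -/

namespace InverseSemigroup

variable {S : Type*} [InverseSemigroup S]

theorem mul_inv_mul_self' (x : S) : x * (x⁻¹ * x) = x := by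
  rw [← mul_assoc, mul_inv_mul_self]

theorem inv_inv' (x : S) : x⁻¹⁻¹ = x :=
  (eq_inv _ _ (inv_mul_inv_self x) (mul_inv_mul_self x)).symm

theorem inv_eq_self {e : S} (he : e * e = e) : e⁻¹ = e :=
  (eq_inv e e (by rw [he, he]) (by rw [he, he])).symm

/-- With `y = (e * f)⁻¹`, the element `f * y * e` is also a generalized inverse of `e * f`, hence
equals `y`. This makes `y` idempotent, so `y` is its own inverse, and `e * f = y`. -/
theorem idem_mul_idem {e f : S} (he : e * e = e) (hf : f * f = f) :
    e * f * (e * f) = e * f := by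
  have h1 := mul_inv_mul_self (e * f)
  have h2 := inv_mul_inv_self (e * f)
  set y := (e * f)⁻¹ with hy
  have hz : f * y * e = y := by
    apply eq_inv
    · calc e * f * (f * y * e) * (e * f) = e * (f * f) * y * (e * e) * f := by
            simp only [mul_assoc]
        _ = e * f * y * (e * f) := by rw [he, hf]; simp only [mul_assoc]
        _ = _ := h1
    · calc f * y * e * (e * f) * (f * y * e) = f * (y * ((e * e) * (f * f)) * y) * e := by
            simp only [mul_assoc]
        _ = f * y * e := by rw [he, hf, h2]
  have hye : y * e = y := by rw [← hz, mul_assoc, he]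
  have hfy : f * y = y := by rw [← hz, ← mul_assoc, ← mul_assoc, hf]
  have hyy : y * y = y := by
    calc y * y = y * e * (f * y) := by rw [hye, hfy]
      _ = y * (e * f) * y := by simp only [mul_assoc]
      _ = y := h2
  have : e * f = y := by
    rw [← inv_inv' (e * f), ← hy, inv_eq_self hyy]
  rw [this, hyy]

/-- Both products are idempotent, so `f * e` is a generalized inverse of `e * f`, which is its own
inverse. -/
theorem idem_comm {e f : S} (he : e * e = e) (hf : f * f = f) : e * f = f * e := by
  have h := idem_mul_idem he hf
  have h' := idem_mul_idem hf he
  rw [← inv_eq_self h]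
  refine (eq_inv _ _ ?_ ?_).symm
  · calc e * f * (f * e) * (e * f) = e * (f * f) * (e * e) * f := by simp only [mul_assoc]
      _ = e * f * (e * f) := by rw [he, hf]; simp only [mul_assoc]
      _ = _ := h
  · calc f * e * (e * f) * (f * e) = f * (e * e) * (f * f) * e := by simp only [mul_assoc]
      _ = f * e * (f * e) := by rw [he, hf]; simp only [mul_assoc]
      _ = _ := h'

/-- The range idempotent `x x⁻¹`. -/
def ran (x : S) : Idem S :=
  ⟨x * x⁻¹, by rw [← mul_assoc, mul_inv_mul_self]⟩

/-- The domain idempotent `x⁻¹ x`. -/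
def dom (x : S) : Idem S :=
  ⟨x⁻¹ * x, by rw [← mul_assoc, inv_mul_inv_self]⟩

theorem coe_ran (x : S) : (ran x : S) = x * x⁻¹ := rfl

theorem coe_dom (x : S) : (dom x : S) = x⁻¹ * x := rfl

theorem ran_mul (x : S) : (ran x : S) * x = x := mul_inv_mul_self x

theorem mul_dom (x : S) : x * (dom x : S) = x := mul_inv_mul_self' x

theorem ran_inv (x : S) : ran x⁻¹ = dom x := by
  apply Subtype.ext
  rw [coe_ran, coe_dom, inv_inv']

theorem dom_inv (x : S) : dom x⁻¹ = ran x := by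
  apply Subtype.ext
  rw [coe_ran, coe_dom, inv_inv']

theorem ran_idem (e : Idem S) : ran (e : S) = e := by
  apply Subtype.ext
  rw [coe_ran, inv_eq_self e.2, e.2]

theorem dom_idem (e : Idem S) : dom (e : S) = e := by
  apply Subtype.ext
  rw [coe_dom, inv_eq_self e.2, e.2]

theorem mul_inv_rev' (x y : S) : (x * y)⁻¹ = y⁻¹ * x⁻¹ := by
  have hc : (ran y : S) * dom x = dom x * ran y := idem_comm (ran y).2 (dom x).2
  rw [coe_ran, coe_dom] at hc
  refine (eq_inv _ _ ?_ ?_).symm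
  · calc x * y * (y⁻¹ * x⁻¹) * (x * y) = x * (y * y⁻¹ * (x⁻¹ * x)) * y := by
          simp only [mul_assoc]
      _ = x * x⁻¹ * x * (y * y⁻¹ * y) := by rw [hc]; simp only [mul_assoc]
      _ = x * y := by rw [mul_inv_mul_self, mul_inv_mul_self]
  · calc y⁻¹ * x⁻¹ * (x * y) * (y⁻¹ * x⁻¹) = y⁻¹ * (x⁻¹ * x * (y * y⁻¹)) * x⁻¹ := by
          simp only [mul_assoc]
      _ = y⁻¹ * y * y⁻¹ * (x⁻¹ * x * x⁻¹) := by rw [← hc]; simp only [mul_assoc]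
      _ = y⁻¹ * x⁻¹ := by rw [inv_mul_inv_self, inv_mul_inv_self]

theorem ran_mul_mul_ran (x y : S) : (ran (x * y) : S) * ran x = ran (x * y) := by
  rw [idem_comm (ran (x * y)).2 (ran x).2, coe_ran (x * y), ← mul_assoc, ← mul_assoc, ran_mul]

theorem dom_mul_mul_dom (x y : S) : (dom (x * y) : S) * dom y = dom (x * y) := by
  rw [coe_dom (x * y), mul_assoc, mul_assoc, mul_dom]

theorem dom_mul_eq (x y : S) : (dom (x * y) : S) = y⁻¹ * dom x * y := by
  simp only [coe_dom, mul_inv_rev', mul_assoc]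

theorem ran_mul_eq (x y : S) : (ran (x * y) : S) = x * ran y * x⁻¹ := by
  simp only [coe_ran, mul_inv_rev', mul_assoc]

/-- When the inner ends match, the product is groupoid composition and the outer ends do not shrink.
-/
theorem ran_mul_of_eq {x y : S} (h : dom x = ran y) : ran (x * y) = ran x := by
  apply Subtype.ext
  rw [ran_mul_eq, ← h, mul_dom, coe_ran]

theorem dom_mul_of_eq {x y : S} (h : dom x = ran y) : dom (x * y) = dom y := by
  apply Subtype.ext
  rw [dom_mul_eq, h, mul_assoc, ran_mul, coe_dom]

/-- The number of idempotents below a given one. -/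
noncomputable def rank (e : Idem S) : ℕ := {g : S | g * g = g ∧ g * e = g}.ncard

theorem rank_le_of_le [Finite S] {e f : Idem S} (h : (e : S) * f = e) : rank e ≤ rank f := by
  refine Set.ncard_le_ncard ?_
  rintro g ⟨h1, h2⟩
  exact ⟨h1, by rw [← h2, mul_assoc, h]⟩

theorem eq_of_le_of_rank_le [Finite S] {e f : Idem S} (h : (e : S) * f = e)
    (hr : rank f ≤ rank e) : e = f := by
  have hsub : {g : S | g * g = g ∧ g * e = g} ⊆ {g : S | g * g = g ∧ g * f = g} := by
    rintro g ⟨h1, h2⟩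
    exact ⟨h1, by rw [← h2, mul_assoc, h]⟩
  have heq := Set.eq_of_subset_of_ncard_le hsub hr
  have hf : (f : S) ∈ {g : S | g * g = g ∧ g * e = g} := by
    rw [heq]
    exact ⟨f.2, f.2⟩
  apply Subtype.ext
  rw [← h, idem_comm e.2 f.2, hf.2]

/-- Conjugation by `x` embeds the idempotents below `ran x` into those below `dom x`; conjugating
back undoes it. Rank is therefore constant on linked idempotents. -/
theorem rank_ran_le_rank_dom [Finite S] (x : S) : rank (ran x) ≤ rank (dom x) := by
  refine Set.ncard_le_ncard_of_injOn (fun g => x⁻¹ * g * x) ?_ ?_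
  · rintro g ⟨h1, h2⟩
    rw [coe_ran] at h2
    refine ⟨?_, ?_⟩
    · calc x⁻¹ * g * x * (x⁻¹ * g * x) = x⁻¹ * (g * (x * x⁻¹)) * g * x := by
            simp only [mul_assoc]
        _ = x⁻¹ * g * x := by rw [h2, mul_assoc x⁻¹, h1]
    · rw [mul_assoc, mul_dom]
  · have key : ∀ g ∈ {g : S | g * g = g ∧ g * (ran x : S) = g}, x * (x⁻¹ * g * x) * x⁻¹ = g := by
      rintro g ⟨h1, h2⟩
      calc x * (x⁻¹ * g * x) * x⁻¹ = ran x * (g * ran x) := by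
            simp only [coe_ran, mul_assoc]
        _ = g := by rw [h2, idem_comm (ran x).2 h1, h2]
    intro g hg g' hg' h
    have h' : x⁻¹ * g * x = x⁻¹ * g' * x := h
    rw [← key g hg, h', key g' hg']

theorem rank_ran_eq_rank_dom [Finite S] (x : S) : rank (ran x) = rank (dom x) := by
  refine le_antisymm (rank_ran_le_rank_dom x) ?_
  have := rank_ran_le_rank_dom x⁻¹
  rwa [ran_inv, dom_inv] at this

/-- Two idempotents are linked if they are the range and the domain of some element. -/
def linked (S : Type*) [InverseSemigroup S] : Setoid (Idem S) where
  r e f := ∃ x : S, ran x = e ∧ dom x = f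
  iseqv :=
    { refl := fun e => ⟨e, ran_idem e, dom_idem e⟩
      symm := by
        rintro e f ⟨x, rfl, rfl⟩
        exact ⟨x⁻¹, ran_inv x, dom_inv x⟩
      trans := by
        rintro e f g ⟨x, rfl, h⟩ ⟨y, rfl, rfl⟩
        exact ⟨x * y, ran_mul_of_eq h, dom_mul_of_eq h⟩ }

/-- The maximal subgroup with identity `e`. -/
def groupAt (e : Idem S) : Subsemigroup S where
  carrier := {x | ran x = e ∧ dom x = e}
  mul_mem' := by
    rintro x y ⟨hx, hx'⟩ ⟨hy, hy'⟩
    have h : dom x = ran y := hx'.trans hy.symm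
    exact ⟨(ran_mul_of_eq h).trans hx, (dom_mul_of_eq h).trans hy'⟩

theorem self_mem_groupAt (e : Idem S) : (e : S) ∈ groupAt e := ⟨ran_idem e, dom_idem e⟩

theorem inv_mem_groupAt {e : Idem S} {x : S} (hx : x ∈ groupAt e) : x⁻¹ ∈ groupAt e :=
  ⟨(ran_inv x).trans hx.2, (dom_inv x).trans hx.1⟩

theorem mul_inv_of_mem_groupAt {e : Idem S} {x : S} (hx : x ∈ groupAt e) : x * x⁻¹ = e := by
  rw [← coe_ran, hx.1]

theorem inv_mul_of_mem_groupAt {e : Idem S} {x : S} (hx : x ∈ groupAt e) : x⁻¹ * x = e := by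
  rw [← coe_dom, hx.2]

theorem idem_mul_of_mem_groupAt {e : Idem S} {x : S} (hx : x ∈ groupAt e) : e * x = x := by
  rw [← hx.1, ran_mul]

theorem mul_idem_of_mem_groupAt {e : Idem S} {x : S} (hx : x ∈ groupAt e) : x * e = x := by
  rw [← hx.2, mul_dom]

/-- A non-empty finite subsemigroup of a maximal subgroup contains the identity. -/
theorem idem_mem_of_le_groupAt [Finite S] {e : Idem S} {K : Subsemigroup S} (hK : K ≤ groupAt e)
    {x : S} (hx : x ∈ K) : (e : S) ∈ K ∧ x⁻¹ ∈ K := by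
  -- Left translation by `x` is injective on the finite `K`, hence onto, so `K` is closed under left
  -- multiplication by `x⁻¹`.
  have hinj : Function.Injective (fun y : K => (⟨x, hx⟩ : K) * y) := by
    intro y z h
    have h' : x * y = x * z := congrArg Subtype.val h
    apply Subtype.ext
    rw [← idem_mul_of_mem_groupAt (hK y.2), ← idem_mul_of_mem_groupAt (hK z.2),
      ← inv_mul_of_mem_groupAt (hK hx), mul_assoc, h', mul_assoc]
  have hsurj := Finite.surjective_of_injective hinj
  have key : ∀ z ∈ K, x⁻¹ * z ∈ K := by
    intro z hz
    obtain ⟨y, hy⟩ := hsurj ⟨z, hz⟩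
    have hy' : x * y = z := congrArg Subtype.val hy
    rw [← hy', ← mul_assoc, inv_mul_of_mem_groupAt (hK hx), idem_mul_of_mem_groupAt (hK y.2)]
    exact y.2
  have he : (e : S) ∈ K := by
    have := key x hx
    rwa [inv_mul_of_mem_groupAt (hK hx)] at this
  refine ⟨he, ?_⟩
  have := key e he
  rwa [mul_idem_of_mem_groupAt (inv_mem_groupAt (hK hx))] at this

/-- Conjugation by an element is an isomorphism between the maximal subgroups at its ends. -/
def groupAtEquiv (x : S) : groupAt (dom x) ≃* groupAt (ran x) where
  toFun g := ⟨x * g * x⁻¹, by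
    have h1 : dom x = ran (g : S) := g.2.1.symm
    have h2 : dom (x * g) = ran x⁻¹ := by rw [dom_mul_of_eq h1, g.2.2, ran_inv]
    exact ⟨by rw [ran_mul_of_eq h2, ran_mul_of_eq h1], by rw [dom_mul_of_eq h2, dom_inv]⟩⟩
  invFun g := ⟨x⁻¹ * g * x, by
    have h1 : dom x⁻¹ = ran (g : S) := by rw [g.2.1, dom_inv]
    have h2 : dom (x⁻¹ * g) = ran x := by rw [dom_mul_of_eq h1, g.2.2]
    exact ⟨by rw [ran_mul_of_eq h2, ran_mul_of_eq h1, ran_inv], by rw [dom_mul_of_eq h2]⟩⟩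
  left_inv g := by
    apply Subtype.ext
    calc x⁻¹ * (x * g * x⁻¹) * x = dom x * (g * dom x) := by simp only [coe_dom, mul_assoc]
      _ = g := by rw [mul_idem_of_mem_groupAt g.2, idem_mul_of_mem_groupAt g.2]
  right_inv g := by
    apply Subtype.ext
    calc x * (x⁻¹ * g * x) * x⁻¹ = ran x * (g * ran x) := by simp only [coe_ran, mul_assoc]
      _ = g := by rw [mul_idem_of_mem_groupAt g.2, idem_mul_of_mem_groupAt g.2]
  map_mul' g h := by
    apply Subtype.ext
    calc x * (g * h : S) * x⁻¹ = x * (g * dom x) * h * x⁻¹ := by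
          rw [mul_idem_of_mem_groupAt g.2]; simp only [mul_assoc]
      _ = x * g * x⁻¹ * (x * h * x⁻¹) := by simp only [coe_dom, mul_assoc]

/-- A generalized inverse found inside `T` is one in `S`, so uniqueness in `S` identifies it with
`x⁻¹`. -/
theorem isInverseSemigroup_coe_iff {T : Subsemigroup S} :
    IsInverseSemigroup T ↔ ∀ x ∈ T, x⁻¹ ∈ T := by
  constructor
  · intro h x hx
    obtain ⟨y, ⟨h1, h2⟩, -⟩ := h ⟨x, hx⟩
    have := eq_inv x y (congrArg Subtype.val h1) (congrArg Subtype.val h2)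
    rw [← this]
    exact y.2
  · intro h x
    refine ⟨⟨(x : S)⁻¹, h x x.2⟩, ⟨Subtype.ext (mul_inv_mul_self _),
      Subtype.ext (inv_mul_inv_self _)⟩, ?_⟩
    rintro y ⟨h1, h2⟩
    exact Subtype.ext (eq_inv _ _ (congrArg Subtype.val h1) (congrArg Subtype.val h2))

end InverseSemigroup

/-! ### Chains of subsemigroups and their maximal size -/

/-- Two chains, one above the other, form a chain. -/
theorem IsChain.union_of_forall_le {α : Type*} [Preorder α] {s t : Set α}
    (hs : IsChain (· ≤ ·) s) (ht : IsChain (· ≤ ·) t) (h : ∀ a ∈ s, ∀ b ∈ t, a ≤ b) :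
    IsChain (· ≤ ·) (s ∪ t) := by
  rintro a (ha | ha) b (hb | hb) hab
  · exact hs ha hb hab
  · exact Or.inl (h a ha b hb)
  · exact Or.inr (h b hb a ha)
  · exact ht ha hb hab

theorem IsChain.finset_image {α β : Type*} [Preorder α] [Preorder β] [DecidableEq β] {C : Finset α}
    (hC : IsChain (· ≤ ·) (C : Set α)) {f : α → β} (hf : Monotone f) :
    IsChain (· ≤ ·) (C.image f : Set β) := by
  rw [Finset.coe_image]
  rintro _ ⟨a, ha, rfl⟩ _ ⟨b, hb, rfl⟩ hab
  exact (hC ha hb fun h => hab (h ▸ rfl)).imp (fun h => hf h) fun h => hf h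

/-- The largest number of non-empty subsemigroups of `S` in a chain. -/
noncomputable def subsemigroupChainNum (S : Type*) [Semigroup S] : ℕ :=
  sSup {k : ℕ | IsSubsemigroupChainCard S k}

theorem subsemigroupLength_eq (S : Type*) [Semigroup S] :
    subsemigroupLength S = subsemigroupChainNum S - 1 := rfl

theorem bddAbove_subsemigroupChainCard (S : Type*) [Semigroup S] [Finite S] :
    BddAbove {k : ℕ | IsSubsemigroupChainCard S k} := by
  refine ⟨(subsemigroupLength S + 1).toNat, fun k hk => ?_⟩
  have := (isGreatest_subsemigroupLength S).2 ⟨k, hk, rfl⟩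
  omega

theorem IsSubsemigroupChainCard.le_chainNum {S : Type*} [Semigroup S] [Finite S] {k : ℕ}
    (h : IsSubsemigroupChainCard S k) : k ≤ subsemigroupChainNum S :=
  le_csSup (bddAbove_subsemigroupChainCard S) h

theorem isSubsemigroupChainCard_chainNum (S : Type*) [Semigroup S] [Finite S] :
    IsSubsemigroupChainCard S (subsemigroupChainNum S) :=
  have hn : {k : ℕ | IsSubsemigroupChainCard S k}.Nonempty := ⟨0, ∅, by simp, by simp, rfl⟩
  Nat.sSup_mem hn (bddAbove_subsemigroupChainCard S)

theorem IsSubsemigroupChainCard.map {S T : Type*} [Semigroup S] [Semigroup T] {k : ℕ}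
    (h : IsSubsemigroupChainCard S k) (f : S →ₙ* T) (hf : Function.Injective f) :
    IsSubsemigroupChainCard T k := by
  classical
  obtain ⟨C, hC, hne, rfl⟩ := h
  refine ⟨C.image (Subsemigroup.map f), ?_, ?_, ?_⟩
  · exact hC.finset_image (Subsemigroup.gc_map_comap _).monotone_l
  · intro U hU
    obtain ⟨V, hV, rfl⟩ := Finset.mem_image.1 hU
    exact (hne V hV).image f
  · exact Finset.card_image_of_injective _ (Subsemigroup.map_injective_of_injective hf)

theorem subsemigroupChainNum_congr {S T : Type*} [Semigroup S] [Semigroup T] [Finite S] [Finite T]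
    (f : S ≃* T) : subsemigroupChainNum S = subsemigroupChainNum T :=
  le_antisymm ((isSubsemigroupChainCard_chainNum S).map f.toMulHom f.injective).le_chainNum
    ((isSubsemigroupChainCard_chainNum T).map f.symm.toMulHom f.symm.injective).le_chainNum

theorem exists_chain_le {S : Type*} [Semigroup S] [Finite S] (H : Subsemigroup S) :
    ∃ C : Finset (Subsemigroup S), IsChain (· ≤ ·) (C : Set (Subsemigroup S)) ∧
      (∀ K ∈ C, (K : Set S).Nonempty ∧ K ≤ H) ∧ C.card = subsemigroupChainNum H := by
  classical
  obtain ⟨C, hC, hne, hcard⟩ := isSubsemigroupChainCard_chainNum H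
  refine ⟨C.image (Subsemigroup.map (MulMemClass.subtype H)), ?_, ?_, ?_⟩
  · exact hC.finset_image (Subsemigroup.gc_map_comap _).monotone_l
  · intro U hU
    obtain ⟨V, hV, rfl⟩ := Finset.mem_image.1 hU
    refine ⟨(hne V hV).image _, ?_⟩
    rintro _ ⟨x, -, rfl⟩
    exact x.2
  · rw [Finset.card_image_of_injective _
      (Subsemigroup.map_injective_of_injective Subtype.val_injective), hcard]

theorem card_le_subsemigroupChainNum {S : Type*} [Semigroup S] [Finite S] {H : Subsemigroup S}
    {C : Finset (Subsemigroup S)} (hC : IsChain (· ≤ ·) (C : Set (Subsemigroup S)))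
    (hH : ∀ K ∈ C, (K : Set S).Nonempty ∧ K ≤ H) : C.card ≤ subsemigroupChainNum H := by
  classical
  refine IsSubsemigroupChainCard.le_chainNum
    ⟨C.image (Subsemigroup.comap (MulMemClass.subtype H)), ?_, ?_, ?_⟩
  · exact hC.finset_image (Subsemigroup.gc_map_comap _).monotone_u
  · intro U hU
    obtain ⟨V, hV, rfl⟩ := Finset.mem_image.1 hU
    obtain ⟨⟨x, hx⟩, hVH⟩ := hH V hV
    exact ⟨⟨x, hVH hx⟩, hx⟩
  · refine Finset.card_image_of_injOn ?_
    intro K hK L hL h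
    ext x
    constructor
    · intro hx
      have : (⟨x, (hH K hK).2 hx⟩ : H) ∈ K.comap (MulMemClass.subtype H) := hx
      rw [h] at this
      exact this
    · intro hx
      have : (⟨x, (hH L hL).2 hx⟩ : H) ∈ L.comap (MulMemClass.subtype H) := hx
      rw [← h] at this
      exact this

/-- The larger subsemigroup can itself be put on top of a longest chain of the smaller one. The
smaller one may be empty. -/
theorem subsemigroupChainNum_strictMono {S : Type*} [Semigroup S] [Finite S] :
    StrictMono fun H : Subsemigroup S => subsemigroupChainNum H := by
  classical
  intro H H' h
  obtain ⟨C, hC, hH, hcard⟩ := exists_chain_le H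
  have hnot : H' ∉ C := fun hmem => h.not_ge (hH _ hmem).2
  change subsemigroupChainNum H < subsemigroupChainNum H'
  rw [← hcard, Nat.lt_iff_add_one_le, ← Finset.card_insert_of_notMem hnot]
  apply card_le_subsemigroupChainNum
  · rw [Finset.coe_insert]
    exact hC.insert fun K hK _ => Or.inr ((hH K hK).2.trans h.le)
  · intro K hK
    rcases Finset.mem_insert.1 hK with rfl | hK
    · obtain ⟨x, hx, -⟩ := SetLike.exists_of_lt h
      exact ⟨⟨x, hx⟩, le_rfl⟩
    · exact ⟨(hH K hK).1, (hH K hK).2.trans h.le⟩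

/-- The largest number of non-empty inverse subsemigroups of `S` in a chain. -/
noncomputable def inverseSubsemigroupChainNum (S : Type*) [Semigroup S] : ℕ :=
  sSup {k : ℕ | IsInverseSubsemigroupChainCard S k}

theorem inverseSubsemigroupLength_eq (S : Type*) [Semigroup S] :
    inverseSubsemigroupLength S = inverseSubsemigroupChainNum S - 1 := rfl

/-- The natural map from the finer quotient to the coarser one is onto; equal finite cardinalities
would make it injective and the relations equal. -/
theorem Setoid.card_quotient_strictAnti {α : Type*} [Finite α] :
    StrictAnti fun s : Setoid α => Nat.card (Quotient s) := by
  intro s t h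
  let f : Quotient s → Quotient t := Quotient.map' id fun _ _ hab => h.le hab
  have hf : Function.Surjective f := by
    rintro ⟨a⟩
    exact ⟨Quotient.mk s a, rfl⟩
  refine lt_of_le_of_ne (Nat.card_le_card_of_surjective f hf) fun hcard => h.not_ge ?_
  have hb := (Nat.bijective_iff_surjective_and_card f).2 ⟨hf, hcard.symm⟩
  intro a b hab
  exact Quotient.exact (hb.1 (Quotient.sound hab : f (Quotient.mk s a) = f (Quotient.mk s b)))

/-! ### Upper bound: a strictly increasing potential -/

namespace InverseSemigroup

variable {S : Type*} [InverseSemigroup S]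

/-- Idempotents that are equal or are the two ends of an element of the inverse-closed
subsemigroup `T`. -/
def linkedIn (T : Subsemigroup S) (hT : ∀ x ∈ T, x⁻¹ ∈ T) : Setoid (Idem S) where
  -- The equality alternative turns idempotents outside `T` into singleton classes, so relations for
  -- different `T` live on the same set.
  r e f := e = f ∨ ∃ x ∈ T, ran x = e ∧ dom x = f
  iseqv :=
    { refl := fun _ => Or.inl rfl
      symm := by
        rintro e f (rfl | ⟨x, hx, rfl, rfl⟩)
        · exact Or.inl rfl
        · exact Or.inr ⟨x⁻¹, hT x hx, ran_inv x, dom_inv x⟩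
      trans := by
        rintro e f g (rfl | ⟨x, hx, rfl, h⟩) (rfl | ⟨y, hy, h', rfl⟩)
        · exact Or.inl rfl
        · exact Or.inr ⟨y, hy, h', rfl⟩
        · exact Or.inr ⟨x, hx, rfl, h⟩
        · have hxy : dom x = ran y := h.trans h'.symm
          exact Or.inr ⟨x * y, T.mul_mem hx hy, ran_mul_of_eq hxy, dom_mul_of_eq hxy⟩ }

/-- An inverse-closed subsemigroup is determined, among those above a given one, by its vertex
groups and its linking relation. -/
theorem eq_of_le_of_groupAt_le {T U : Subsemigroup S} (hT : ∀ x ∈ T, x⁻¹ ∈ T)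
    (hU : ∀ x ∈ U, x⁻¹ ∈ U) (h : T ≤ U) (hg : ∀ e, U ⊓ groupAt e ≤ T)
    (hl : linkedIn U hU ≤ linkedIn T hT) : T = U := by
  refine le_antisymm h fun x hx => ?_
  -- Either `x` has equal ends and lies in a vertex group, or some `y` in `T` is parallel to `x`.
  -- Then `y⁻¹ * x` lies in a vertex group, and `x = y * (y⁻¹ * x)`.
  rcases hl (Or.inr ⟨x, hx, rfl, rfl⟩ : linkedIn U hU (ran x) (dom x)) with h' | ⟨y, hy, hr, hd⟩
  · exact hg (ran x) ⟨hx, rfl, h'.symm⟩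
  · have h1 : dom y⁻¹ = ran x := by rw [dom_inv, hr]
    have h2 : y⁻¹ * x ∈ T := by
      refine hg (dom x) ⟨U.mul_mem (hU y (h hy)) hx, ?_, ?_⟩
      · rw [ran_mul_of_eq h1, ran_inv, hd]
      · rw [dom_mul_of_eq h1]
    have h3 : x = y * (y⁻¹ * x) := by
      rw [← mul_assoc, ← coe_ran, hr, ran_mul]
    rw [h3]
    exact T.mul_mem hy h2

section Potential

variable [Finite S] [Fintype (Idem S)]

/-- The total length of the vertex groups of `T`, plus the rank of its linking relation. -/
noncomputable def potential (T : {T : Subsemigroup S // ∀ x ∈ T, x⁻¹ ∈ T}) : ℤ :=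
  ∑ e : Idem S, (subsemigroupChainNum (T.1 ⊓ groupAt e : Subsemigroup S) : ℤ) +
    Fintype.card (Idem S) - Nat.card (Quotient (linkedIn T.1 T.2))

/-- Each vertex term, and the number of merges, is weakly increasing. Equal totals force equality in
every term, hence equal vertex groups and equal linking, and `eq_of_le_of_groupAt_le` applies. -/
theorem potential_strictMono : StrictMono (potential (S := S)) := by
  rintro ⟨T, hT⟩ ⟨U, hU⟩ hTU
  have hle : T ≤ U := hTU.le
  have hN : ∀ e : Idem S, (subsemigroupChainNum (T ⊓ groupAt e : Subsemigroup S) : ℤ) ≤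
      subsemigroupChainNum (U ⊓ groupAt e : Subsemigroup S) := fun e =>
    Nat.cast_le.2 (subsemigroupChainNum_strictMono.monotone (inf_le_inf_right _ hle))
  have hS := Finset.sum_le_sum fun e (_ : e ∈ Finset.univ) => hN e
  have hll : linkedIn T hT ≤ linkedIn U hU := by
    rintro e f (rfl | ⟨x, hx, h⟩)
    · exact Or.inl rfl
    · exact Or.inr ⟨x, hle hx, h⟩
  have hQ := Setoid.card_quotient_strictAnti.antitone hll
  change Nat.card (Quotient (linkedIn U hU)) ≤ Nat.card (Quotient (linkedIn T hT)) at hQ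
  by_contra hlt
  simp only [potential, not_lt] at hlt
  have hSeq := le_antisymm hS (by omega)
  have hQeq : Nat.card (Quotient (linkedIn U hU)) = Nat.card (Quotient (linkedIn T hT)) :=
    le_antisymm hQ (by omega)
  refine hTU.ne (Subtype.ext (eq_of_le_of_groupAt_le hT hU hle ?_ ?_))
  · intro e
    have he := (Finset.sum_eq_sum_iff_of_le fun e _ => hN e).1 hSeq e (Finset.mem_univ e)
    by_contra hnot
    have hlt' : T ⊓ groupAt e < U ⊓ groupAt e :=
      lt_of_le_of_ne (inf_le_inf_right _ hle) fun h => hnot (h ▸ inf_le_left)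
    have := subsemigroupChainNum_strictMono hlt'
    change subsemigroupChainNum _ < subsemigroupChainNum _ at this
    omega
  · by_contra hnot
    have hlt' : linkedIn T hT < linkedIn U hU := lt_of_le_not_ge hll hnot
    exact (Setoid.card_quotient_strictAnti hlt').ne hQeq

theorem potential_bot_nonneg :
    0 ≤ potential (⟨⊥, fun _ h => h.elim⟩ : {T : Subsemigroup S // ∀ x ∈ T, x⁻¹ ∈ T}) := by
  have h : Nat.card (Quotient (linkedIn (⊥ : Subsemigroup S) fun _ h => h.elim)) ≤
      Fintype.card (Idem S) := by
    rw [← Nat.card_eq_fintype_card]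
    exact Nat.card_le_card_of_surjective (Quotient.mk _) Quotient.mk_surjective
  have h' : 0 ≤ ∑ e : Idem S,
      (subsemigroupChainNum ((⊥ : Subsemigroup S) ⊓ groupAt e : Subsemigroup S) : ℤ) :=
    Finset.sum_nonneg fun _ _ => Nat.cast_nonneg _
  simp only [potential]
  omega

/-- The potential embeds the chain in the integers from 1 to its value at `⊤`: non-empty members lie
strictly above `⊥`, whose potential is nonnegative. -/
theorem card_chain_le {C : Finset (Subsemigroup S)}
    (hC : IsChain (· ≤ ·) (C : Set (Subsemigroup S)))
    (hI : ∀ T ∈ C, (T : Set S).Nonempty ∧ IsInverseSemigroup T) :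
    (C.card : ℤ) + Nat.card (Quotient (linked S)) ≤
      ∑ e : Idem S, (subsemigroupChainNum (groupAt e) : ℤ) + Fintype.card (Idem S) := by
  have hinv : ∀ T ∈ C, ∀ x ∈ T, x⁻¹ ∈ T := fun T hT => isInverseSemigroup_coe_iff.1 (hI T hT).2
  have htop : potential (⟨⊤, by simp⟩ : {T : Subsemigroup S // ∀ x ∈ T, x⁻¹ ∈ T}) =
      ∑ e : Idem S, (subsemigroupChainNum (groupAt e) : ℤ) + Fintype.card (Idem S) -
        Nat.card (Quotient (linked S)) := by
    have hl : linkedIn (⊤ : Subsemigroup S) (by simp) = linked S := by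
      ext e f
      constructor
      · rintro (rfl | ⟨x, -, h⟩)
        · exact (linked S).refl _
        · exact ⟨x, h⟩
      · rintro ⟨x, h⟩
        exact Or.inr ⟨x, trivial, h⟩
    have hg : ∀ e : Idem S, subsemigroupChainNum (⊤ ⊓ groupAt e : Subsemigroup S) =
        subsemigroupChainNum (groupAt e) := fun e => by rw [top_inf_eq]
    simp only [potential, hg, hl]
  have hcard : C.attach.card ≤ (Finset.Icc 1 (potential (S := S) ⟨⊤, by simp⟩)).card := by
    refine Finset.card_le_card_of_injOn (fun T => potential ⟨T.1, hinv T.1 T.2⟩) ?_ ?_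
    · intro T _
      have hpos : (⟨⊥, fun _ h => h.elim⟩ : {T : Subsemigroup S // ∀ x ∈ T, x⁻¹ ∈ T}) <
          ⟨T.1, hinv T.1 T.2⟩ := by
        refine lt_of_le_of_ne (bot_le : (⊥ : Subsemigroup S) ≤ T.1) fun h => ?_
        obtain ⟨x, hx⟩ := (hI T.1 T.2).1
        have h' : (⊥ : Subsemigroup S) = T.1 := congrArg Subtype.val h
        rw [← h'] at hx
        exact hx
      have h1 := potential_strictMono hpos
      have h2 := potential_bot_nonneg (S := S)
      have h3 : potential ⟨T.1, hinv T.1 T.2⟩ ≤ potential (S := S) ⟨⊤, by simp⟩ :=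
        potential_strictMono.monotone (le_top : T.1 ≤ (⊤ : Subsemigroup S))
      simp only [Finset.coe_Icc, Set.mem_Icc]
      omega
    · rintro ⟨T, hT⟩ _ ⟨U, hU⟩ _ h
      apply Subtype.ext
      by_contra hne
      rcases hC hT hU hne with h' | h'
      · exact (potential_strictMono (a := ⟨T, hinv T hT⟩) (b := ⟨U, hinv U hU⟩)
          (lt_of_le_of_ne h' hne : T < U)).ne h
      · exact (potential_strictMono (a := ⟨U, hinv U hU⟩) (b := ⟨T, hinv T hT⟩)
          (lt_of_le_of_ne h' (Ne.symm hne) : U < T)).ne h.symm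
  have h2 := potential_bot_nonneg (S := S)
  have h3 : potential (S := S) ⟨⊥, fun _ h => h.elim⟩ ≤ potential (S := S) ⟨⊤, by simp⟩ :=
    potential_strictMono.monotone (bot_le : (⊥ : Subsemigroup S) ≤ (⊤ : Subsemigroup S))
  rw [Finset.card_attach, Int.card_Icc] at hcard
  omega

end Potential

end InverseSemigroup

/-! ### Lower bound: adjoining idempotents by rank -/

namespace InverseSemigroup

variable {S : Type*} [InverseSemigroup S]

/-- A set of idempotents is rank-closed if it contains every idempotent whose rank is smaller than
that of some member. -/
def RankClosed (A : Finset (Idem S)) : Prop :=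
  ∀ f ∈ A, ∀ e, rank e < rank f → e ∈ A

variable [Finite S]

theorem RankClosed.mem_of_le {A : Finset (Idem S)} (hA : RankClosed A) {e f : Idem S}
    (h : (e : S) * f = e) (hf : f ∈ A) : e ∈ A := by
  by_cases hr : rank f ≤ rank e
  · rwa [eq_of_le_of_rank_le h hr]
  · exact hA f hf e (not_le.1 hr)

/-- The elements whose range and domain belong to a given rank-closed set. -/
def fullOn (A : Finset (Idem S)) (hA : RankClosed A) : Subsemigroup S where
  carrier := {x | ran x ∈ A ∧ dom x ∈ A}
  mul_mem' := by
    rintro x y ⟨hx, -⟩ ⟨-, hy⟩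
    exact ⟨hA.mem_of_le (ran_mul_mul_ran x y) hx, hA.mem_of_le (dom_mul_mul_dom x y) hy⟩

theorem mem_fullOn {A : Finset (Idem S)} {hA : RankClosed A} {x : S} :
    x ∈ fullOn A hA ↔ ran x ∈ A ∧ dom x ∈ A := Iff.rfl

theorem inv_mem_fullOn {A : Finset (Idem S)} {hA : RankClosed A} {x : S} (hx : x ∈ fullOn A hA) :
    x⁻¹ ∈ fullOn A hA := by
  rw [mem_fullOn, ran_inv, dom_inv]
  exact ⟨hx.2, hx.1⟩

/-- The domain of `x * y` lies below `e`. If strictly below, its rank is smaller and `hmin` puts it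
in `A`. If it equals `e`, conjugating by `y` gives `e` below `dom x`, which would force `e ∈ A`. -/
theorem mul_mem_fullOn {A : Finset (Idem S)} {hA : RankClosed A} {e : Idem S} (he : e ∉ A)
    (hmin : ∀ g, rank g < rank e → g ∈ A) {x y : S} (hx : x ∈ fullOn A hA)
    (hy : y ∈ groupAt e) : x * y ∈ fullOn A hA := by
  refine ⟨hA.mem_of_le (ran_mul_mul_ran x y) hx.1, ?_⟩
  have hle : (dom (x * y) : S) * e = dom (x * y) := by
    rw [← hy.2, dom_mul_mul_dom]
  by_cases hr : rank e ≤ rank (dom (x * y))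
  · exfalso
    have heq := congrArg Subtype.val (eq_of_le_of_rank_le hle hr)
    rw [dom_mul_eq] at heq
    refine he (hA.mem_of_le (f := dom x) ?_ hx.2)
    calc (e : S) * dom x = e * (e * dom x) := by rw [← mul_assoc, e.2]
      _ = e * dom x * e := by rw [idem_comm e.2 (dom x).2, ← mul_assoc, idem_comm e.2 (dom x).2]
      _ = y * (y⁻¹ * dom x * y) * y⁻¹ := by
          rw [← mul_inv_of_mem_groupAt hy]; simp only [mul_assoc]
      _ = e := by rw [heq, mul_idem_of_mem_groupAt hy, mul_inv_of_mem_groupAt hy]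
  · exact hmin _ (not_le.1 hr)

/-- The subsemigroup `fullOn A` extended by a subgroup at a further idempotent of minimal rank. -/
def fullOnSup (A : Finset (Idem S)) (hA : RankClosed A) (e : Idem S) (he : e ∉ A)
    (hmin : ∀ g, rank g < rank e → g ∈ A) (K : Subsemigroup S) : Subsemigroup S where
  carrier := {x | x ∈ fullOn A hA ∨ x ∈ K ⊓ groupAt e}
  mul_mem' := by
    rintro x y (hx | hx) (hy | hy)
    · exact Or.inl (mul_mem hx hy)
    · exact Or.inl (mul_mem_fullOn he hmin hx hy.2)
    · refine Or.inl ?_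
      -- The other-sided product reduces to `mul_mem_fullOn` by taking inverses.
      have := inv_mem_fullOn
        (mul_mem_fullOn he hmin (inv_mem_fullOn hy) (inv_mem_groupAt hx.2))
      rwa [mul_inv_rev', inv_inv', inv_inv'] at this
    · exact Or.inr (mul_mem hx hy)

theorem monotone_fullOnSup {A : Finset (Idem S)} {hA : RankClosed A} {e : Idem S} {he : e ∉ A}
    {hmin : ∀ g, rank g < rank e → g ∈ A} : Monotone (fullOnSup A hA e he hmin) :=
  fun _ _ h _ hx => hx.imp_right fun hx => ⟨h hx.1, hx.2⟩

/-- Elements of `fullOn A` have range in `A`, so none lies over `e`. Thus `K` is recovered, and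
distinct `K` give distinct extensions. -/
theorem fullOnSup_inf_groupAt {A : Finset (Idem S)} {hA : RankClosed A} {e : Idem S} {he : e ∉ A}
    {hmin : ∀ g, rank g < rank e → g ∈ A} {K : Subsemigroup S} (hK : K ≤ groupAt e) :
    fullOnSup A hA e he hmin K ⊓ groupAt e = K := by
  ext x
  constructor
  · rintro ⟨hx | hx, hx'⟩
    · exact absurd (hx'.1 ▸ hx.1) he
    · exact hx.1
  · intro hx
    exact ⟨Or.inr ⟨hx, hK hx⟩, hK hx⟩

open Classical in
/-- A chain of inverse subsemigroups on a rank-closed set of idempotents, built by adjoining the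
idempotents one at a time. -/
theorem exists_chain_of_rankClosed (A : Finset (Idem S)) (hA : RankClosed A) :
    ∃ C : Finset (Subsemigroup S), IsChain (· ≤ ·) (C : Set (Subsemigroup S)) ∧
      (∀ T ∈ C, (T : Set S).Nonempty ∧ (∀ x ∈ T, x⁻¹ ∈ T) ∧ T ≤ fullOn A hA) ∧
      ∑ e ∈ A, subsemigroupChainNum (groupAt e) + A.card ≤
        C.card + (A.image (Quotient.mk (linked S))).card := by
  -- The last idempotent `e` has maximal rank, so removing it leaves a rank-closed set, and every
  -- idempotent of smaller rank is already present.
  induction A using Finset.induction_on_max_value (rank (S := S)) with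
  | empty => exact ⟨∅, by simp, by simp, by simp⟩
  | insert e A he hmax ih =>
    have hA' : RankClosed A := fun f hf g hg => by
      rcases Finset.mem_insert.1 (hA f (Finset.mem_insert_of_mem hf) g hg) with rfl | h
      · exact absurd (hmax f hf) hg.not_ge
      · exact h
    have hmin : ∀ g, rank g < rank e → g ∈ A := fun g hg => by
      rcases Finset.mem_insert.1 (hA e (Finset.mem_insert_self _ _) g hg) with rfl | h
      · exact absurd hg (lt_irrefl _)
      · exact h
    obtain ⟨C, hC, hCprop, hCcard⟩ := ih hA'
    obtain ⟨D, hD, hDprop, hDcard⟩ := exists_chain_le (groupAt e)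
    have hmono : fullOn A hA' ≤ fullOn (insert e A) hA := fun x hx =>
      ⟨Finset.mem_insert_of_mem hx.1, Finset.mem_insert_of_mem hx.2⟩
    have hmono' : ∀ K, fullOnSup A hA' e he hmin K ≤ fullOn (insert e A) hA := by
      rintro K x (hx | hx)
      · exact hmono hx
      · exact ⟨by rw [hx.2.1]; exact Finset.mem_insert_self _ _,
          by rw [hx.2.2]; exact Finset.mem_insert_self _ _⟩
    let D' := D.image (fullOnSup A hA' e he hmin)
    have hD' : IsChain (· ≤ ·) (D' : Set (Subsemigroup S)) := hD.finset_image monotone_fullOnSup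
    have hD'card : D'.card = D.card := by
      refine Finset.card_image_of_injOn fun K hK L hL h => ?_
      rw [← fullOnSup_inf_groupAt (he := he) (hmin := hmin) (hA := hA') (hDprop K hK).2,
        ← fullOnSup_inf_groupAt (he := he) (hmin := hmin) (hA := hA') (hDprop L hL).2]
      exact congrArg (· ⊓ groupAt e) h
    have hD'prop : ∀ T ∈ D', (e : S) ∈ T ∧ (∀ x ∈ T, x⁻¹ ∈ T) ∧ fullOn A hA' ≤ T ∧
        ∃ K, T = fullOnSup A hA' e he hmin K := by
      intro T hT
      obtain ⟨K, hK, rfl⟩ := Finset.mem_image.1 hT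
      obtain ⟨⟨x, hx⟩, hKe⟩ := hDprop K hK
      refine ⟨Or.inr ⟨(idem_mem_of_le_groupAt hKe hx).1, self_mem_groupAt e⟩, ?_,
        fun x hx => Or.inl hx, K, rfl⟩
      rintro y (hy | hy)
      · exact Or.inl (inv_mem_fullOn hy)
      · exact Or.inr ⟨(idem_mem_of_le_groupAt hKe hy.1).2, inv_mem_groupAt hy.2⟩
    have hCD : ∀ T ∈ C, ∀ U ∈ D', T ≤ U := fun T hT U hU =>
      (hCprop T hT).2.2.trans (hD'prop U hU).2.2.1
    have hdisj : Disjoint C D' := by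
      rw [Finset.disjoint_left]
      intro T hT hT'
      have := ((hCprop T hT).2.2 (hD'prop T hT').1).1
      rw [ran_idem] at this
      exact he this
    have hE : IsChain (· ≤ ·) ((C ∪ D' : Finset (Subsemigroup S)) : Set (Subsemigroup S)) := by
      rw [Finset.coe_union]
      exact hC.union_of_forall_le hD' hCD
    have hEprop : ∀ T ∈ C ∪ D', (T : Set S).Nonempty ∧ (∀ x ∈ T, x⁻¹ ∈ T) ∧
        T ≤ fullOn (insert e A) hA := by
      intro T hT
      rcases Finset.mem_union.1 hT with hT | hT
      · exact ⟨(hCprop T hT).1, (hCprop T hT).2.1, (hCprop T hT).2.2.trans hmono⟩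
      · obtain ⟨h1, h2, -, K, rfl⟩ := hD'prop T hT
        exact ⟨⟨e, h1⟩, h2, hmono' K⟩
    have hEcard : (C ∪ D').card = C.card + subsemigroupChainNum (groupAt e) := by
      rw [Finset.card_union_of_disjoint hdisj, hD'card, hDcard]
    rw [Finset.sum_insert he, Finset.card_insert_of_notMem he, Finset.image_insert]
    -- The vertex group at `e` has supplied its chain number; one more unit is needed. If `e` is
    -- linked to an earlier `f`, the linking element lies in no member so far, so the full
    -- subsemigroup is a new top. Otherwise the number of components grows by one.
    by_cases hlink : Quotient.mk (linked S) e ∈ A.image (Quotient.mk (linked S))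
    · obtain ⟨f, hf, hfe⟩ := Finset.mem_image.1 hlink
      obtain ⟨x, hxf, hxe⟩ := Quotient.exact hfe
      have hnotle : ∀ T ∈ C ∪ D', x ∉ T := by
        intro T hT hx
        rcases Finset.mem_union.1 hT with hT | hT
        · have := ((hCprop T hT).2.2 hx).2
          rw [hxe] at this
          exact he this
        · obtain ⟨-, -, -, K, rfl⟩ := hD'prop T hT
          rcases hx with hx | hx
          · exact he (hxe ▸ hx.2)
          · have hfe : f = e := hxf.symm.trans hx.2.1
            exact he (hfe ▸ hf)
      have hx : x ∈ fullOn (insert e A) hA :=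
        ⟨by rw [hxf]; exact Finset.mem_insert_of_mem hf,
          by rw [hxe]; exact Finset.mem_insert_self _ _⟩
      have hnot : fullOn (insert e A) hA ∉ C ∪ D' := fun h => hnotle _ h hx
      refine ⟨insert (fullOn (insert e A) hA) (C ∪ D'), ?_, ?_, ?_⟩
      · rw [Finset.coe_insert]
        exact hE.insert fun T hT _ => Or.inr (hEprop T hT).2.2
      · intro T hT
        rcases Finset.mem_insert.1 hT with rfl | hT
        · exact ⟨⟨x, hx⟩, fun _ => inv_mem_fullOn, le_rfl⟩
        · exact hEprop T hT
      · rw [Finset.card_insert_of_notMem hnot, hEcard, Finset.insert_eq_of_mem hlink]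
        omega
    · refine ⟨C ∪ D', hE, hEprop, ?_⟩
      rw [hEcard, Finset.card_insert_of_notMem hlink]
      omega

/-- The length of a finite inverse semigroup in terms of its maximal subgroups and the linking
relation on its idempotents. -/
theorem inverseSubsemigroupChainNum_add_card_quotient [Fintype (Idem S)] :
    inverseSubsemigroupChainNum S + Nat.card (Quotient (linked S)) =
      ∑ e : Idem S, subsemigroupChainNum (groupAt e) + Fintype.card (Idem S) := by
  classical
  have hb : BddAbove {k : ℕ | IsInverseSubsemigroupChainCard S k} := by
    refine ⟨(inverseSubsemigroupLength S + 1).toNat, fun k hk => ?_⟩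
    have := (isGreatest_inverseSubsemigroupLength S).2 ⟨k, hk, rfl⟩
    omega
  have hn : {k : ℕ | IsInverseSubsemigroupChainCard S k}.Nonempty :=
    ⟨0, ∅, by simp, by simp, rfl⟩
  apply le_antisymm
  · obtain ⟨C, hC, hI, hcard⟩ := Nat.sSup_mem hn hb
    have := card_chain_le hC hI
    rw [hcard] at this
    exact_mod_cast this
  · obtain ⟨C, hC, hCprop, hcard⟩ := exists_chain_of_rankClosed (S := S) Finset.univ
      fun _ _ e _ => Finset.mem_univ e
    have hle : C.card ≤ inverseSubsemigroupChainNum S := le_csSup hb ⟨C, hC, fun T hT =>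
      ⟨(hCprop T hT).1, isInverseSemigroup_coe_iff.2 (hCprop T hT).2.1⟩, rfl⟩
    have him : (Finset.univ.image (Quotient.mk (linked S))).card ≤
        Nat.card (Quotient (linked S)) := by
      have : Fintype (Quotient (linked S)) := Fintype.ofFinite _
      rw [Nat.card_eq_fintype_card]
      exact Finset.card_le_univ _
    rw [Finset.card_univ] at hcard
    omega

/-- The length of a finite inverse semigroup, with its linking classes labelled by `ι`. -/
theorem inverseSubsemigroupChainNum_add_card [Fintype (Idem S)] {ι : Type*} [Fintype ι]
    (p : Idem S → ι) (hp : Function.Surjective p)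
    (hl : ∀ e f, p e = p f ↔ ∃ x : S, ran x = e ∧ dom x = f) :
    inverseSubsemigroupChainNum S + Fintype.card ι =
      ∑ e : Idem S, subsemigroupChainNum (groupAt e) + Fintype.card (Idem S) := by
  have h : Setoid.ker p = linked S := Setoid.ext fun e f => hl e f
  rw [← inverseSubsemigroupChainNum_add_card_quotient, ← h,
    Nat.card_congr (Setoid.quotientKerEquivOfSurjective p hp), Nat.card_eq_fintype_card]

end InverseSemigroup

/-! ### Brandt semigroups -/

theorem subsemigroupChainNum_of_subsingleton (S : Type*) [Semigroup S] [Subsingleton S]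
    [Nonempty S] : subsemigroupChainNum S = 1 := by
  have : Finite S := Finite.of_subsingleton
  apply le_antisymm
  · obtain ⟨C, -, hne, hcard⟩ := isSubsemigroupChainCard_chainNum S
    rw [← hcard, Finset.card_le_one]
    have key : ∀ T ∈ C, T = ⊤ := fun T hT => by
      obtain ⟨x, hx⟩ := hne T hT
      exact eq_top_iff.2 fun y _ => Subsingleton.elim x y ▸ hx
    exact fun T hT U hU => (key T hT).trans (key U hU).symm
  · obtain ⟨x⟩ := ‹Nonempty S›
    exact IsSubsemigroupChainCard.le_chainNum
      ⟨{⊤}, by simp, fun T hT => by rw [Finset.mem_singleton.1 hT]; exact ⟨x, trivial⟩, by simp⟩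

namespace BrandtSemigroup

open InverseSemigroup

variable {G : Type*} {n : ℕ}

instance [Finite G] : Finite (BrandtSemigroup G n) := by
  refine Finite.of_surjective (fun o : Option (Fin n × G × Fin n) =>
    o.elim BrandtSemigroup.zero fun t => BrandtSemigroup.elem t.1 t.2.1 t.2.2) ?_
  rintro (_ | ⟨i, g, j⟩)
  · exact ⟨none, rfl⟩
  · exact ⟨some (i, g, j), rfl⟩

variable [Group G]

theorem zero_mul' (x : BrandtSemigroup G n) : zero * x = zero := by
  cases x <;> rfl

theorem mul_zero' (x : BrandtSemigroup G n) : x * zero = zero := by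
  cases x <;> rfl

theorem elem_mul_elem (i j k l : Fin n) (g h : G) :
    elem i g j * elem k h l = if j = k then elem i (g * h) l else zero := rfl

theorem elem_mul_elem_self (i j l : Fin n) (g h : G) :
    elem i g j * elem j h l = elem i (g * h) l := if_pos rfl

/-- The inverse operation of a Brandt semigroup. -/
protected def inv : BrandtSemigroup G n → BrandtSemigroup G n
  | elem i g j => elem j g⁻¹ i
  | zero => zero

instance : InverseSemigroup (BrandtSemigroup G n) :=
  { BrandtSemigroup.instSemigroup with
    inv := BrandtSemigroup.inv
    mul_inv_mul_self := by
      rintro (_ | ⟨i, g, j⟩)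
      · rfl
      · change elem i g j * elem j g⁻¹ i * elem i g j = _
        simp [elem_mul_elem_self]
    inv_mul_inv_self := by
      rintro (_ | ⟨i, g, j⟩)
      · rfl
      · change elem j g⁻¹ i * elem i g j * elem j g⁻¹ i = elem j g⁻¹ i
        simp [elem_mul_elem_self]
    eq_inv := by
      rintro (_ | ⟨i, g, j⟩) y h1 h2
      · rw [mul_zero', zero_mul'] at h2
        exact h2.symm
      · rcases y with _ | ⟨k, h, l⟩
        · rw [mul_zero', zero_mul'] at h1
          cases h1
        · rw [elem_mul_elem] at h1
          split_ifs at h1 with hjk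
          · rw [elem_mul_elem] at h1
            split_ifs at h1 with hli
            · subst hjk hli
              injection h1 with _ h1 _
              change elem j h l = elem j g⁻¹ l
              rw [mul_eq_right, mul_eq_one_iff_eq_inv'] at h1
              rw [h1]
          · rw [zero_mul'] at h1
            cases h1 }

theorem inv_elem (i j : Fin n) (g : G) : (elem i g j)⁻¹ = elem j g⁻¹ i := rfl

/-- The idempotents of a Brandt semigroup are the zero and the elements `(i, 1, i)`. -/
def idemEquiv : Option (Fin n) ≃ Idem (BrandtSemigroup G n) where
  toFun o := o.elim ⟨zero, rfl⟩ fun i => ⟨elem i 1 i, by rw [elem_mul_elem_self, one_mul]⟩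
  invFun
    | ⟨zero, _⟩ => none
    | ⟨elem i _ _, _⟩ => some i
  left_inv := by rintro (_ | i) <;> rfl
  right_inv := by
    rintro ⟨_ | ⟨i, g, j⟩, h⟩
    · rfl
    · apply Subtype.ext
      change elem i 1 i = elem i g j
      rw [elem_mul_elem] at h
      split_ifs at h with hji
      subst hji
      injection h with _ h _
      rw [mul_eq_left.1 h]

theorem coe_idemEquiv_some (i : Fin n) :
    (idemEquiv (some i) : Idem (BrandtSemigroup G n)).1 = elem i 1 i := rfl

theorem ran_elem (i j : Fin n) (g : G) : ran (elem i g j) = idemEquiv (some i) := by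
  apply Subtype.ext
  rw [coe_ran, inv_elem, elem_mul_elem_self, mul_inv_cancel, coe_idemEquiv_some]

theorem dom_elem (i j : Fin n) (g : G) : dom (elem i g j) = idemEquiv (some j) := by
  apply Subtype.ext
  rw [coe_dom, inv_elem, elem_mul_elem_self, inv_mul_cancel, coe_idemEquiv_some]

theorem ran_zero : ran (zero : BrandtSemigroup G n) = idemEquiv none := rfl

theorem dom_zero : dom (zero : BrandtSemigroup G n) = idemEquiv none := rfl

theorem subsingleton_groupAt_none :
    Subsingleton (groupAt (idemEquiv none : Idem (BrandtSemigroup G n))) := by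
  have key : ∀ x : groupAt (idemEquiv none : Idem (BrandtSemigroup G n)), x.1 = zero := by
    rintro ⟨_ | ⟨i, g, j⟩, h⟩
    · rfl
    · have h' := h.1
      rw [ran_elem, idemEquiv.apply_eq_iff_eq] at h'
      cases h'
  exact ⟨fun x y => Subtype.ext ((key x).trans (key y).symm)⟩

/-- The maximal subgroups of a Brandt semigroup outside zero are copies of `G`. -/
noncomputable def groupAtSomeEquiv (i : Fin n) :
    G ≃* groupAt (idemEquiv (some i) : Idem (BrandtSemigroup G n)) :=
  MulEquiv.ofBijective
    ({ toFun := fun g => ⟨elem i g i, ran_elem i i g, dom_elem i i g⟩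
       map_mul' := fun g h => Subtype.ext (elem_mul_elem_self i i i g h).symm } :
      G →ₙ* groupAt (idemEquiv (some i) : Idem (BrandtSemigroup G n)))
    ⟨fun g h hgh => by
      have := congrArg Subtype.val hgh
      injection this, by
      rintro ⟨_ | ⟨j, g, k⟩, h⟩
      · have h' : idemEquiv none = idemEquiv (some i) := h.1
        rw [idemEquiv.apply_eq_iff_eq] at h'
        cases h'
      · have h1 := h.1
        have h2 := h.2
        rw [ran_elem, idemEquiv.apply_eq_iff_eq] at h1
        rw [dom_elem, idemEquiv.apply_eq_iff_eq] at h2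
        cases h1
        cases h2
        exact ⟨g, rfl⟩⟩

/-- There are two components, the zero and the rest, labelled by `Bool`; `n ≠ 0` makes the second
non-empty. The zero contributes 1 + 1, which cancels the two components, and each of the other `n`
idempotents contributes N(`G`) + 1. -/
theorem inverseSubsemigroupLength_eq [Finite G] (hn : n ≠ 0) :
    inverseSubsemigroupLength (BrandtSemigroup G n) =
      n * (subsemigroupLength G + 1) + n - 1 := by
  have : NeZero n := ⟨hn⟩
  let : Fintype (Idem (BrandtSemigroup G n)) := Fintype.ofEquiv _ idemEquiv
  have key := inverseSubsemigroupChainNum_add_card (S := BrandtSemigroup G n)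
    (fun e => (idemEquiv.symm e).isSome)
    (by
      rintro (_ | _)
      · exact ⟨idemEquiv none, by simp⟩
      · exact ⟨idemEquiv (some 0), by simp⟩)
    (by
      intro e f
      obtain ⟨e, rfl⟩ := idemEquiv.surjective e
      obtain ⟨f, rfl⟩ := idemEquiv.surjective f
      simp only [Equiv.symm_apply_apply]
      constructor
      · rcases e with _ | i <;> rcases f with _ | j
        · exact fun _ => ⟨zero, ran_zero, dom_zero⟩
        · exact fun h => absurd h (by simp)
        · exact fun h => absurd h (by simp)
        · exact fun _ => ⟨elem i 1 j, ran_elem i j 1, dom_elem i j 1⟩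
      · rintro ⟨_ | ⟨i, g, j⟩, h1, h2⟩
        · rw [ran_zero, idemEquiv.apply_eq_iff_eq] at h1
          rw [dom_zero, idemEquiv.apply_eq_iff_eq] at h2
          rw [← h1, ← h2]
        · rw [ran_elem, idemEquiv.apply_eq_iff_eq] at h1
          rw [dom_elem, idemEquiv.apply_eq_iff_eq] at h2
          rw [← h1, ← h2]
          rfl)
  have hzero : subsemigroupChainNum
      (groupAt (idemEquiv none : Idem (BrandtSemigroup G n))) = 1 := by
    have := subsingleton_groupAt_none (G := G) (n := n)
    have : Nonempty (groupAt (idemEquiv none : Idem (BrandtSemigroup G n))) :=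
      ⟨⟨_, self_mem_groupAt _⟩⟩
    exact subsemigroupChainNum_of_subsingleton _
  have hsome : ∀ i : Fin n, subsemigroupChainNum
      (groupAt (idemEquiv (some i) : Idem (BrandtSemigroup G n))) = subsemigroupChainNum G :=
    fun i => (subsemigroupChainNum_congr (groupAtSomeEquiv i)).symm
  rw [← idemEquiv.sum_comp, Fintype.sum_option, hzero, Finset.sum_congr rfl fun i _ => hsome i,
    ← Fintype.card_congr (idemEquiv (G := G) (n := n)), Fintype.card_option, Fintype.card_fin,
    Fintype.card_bool, Finset.sum_const, Finset.card_univ, Fintype.card_fin, smul_eq_mul] at key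
  zify at key
  rw [_root_.inverseSubsemigroupLength_eq, subsemigroupLength_eq]
  linarith

end BrandtSemigroup

/-! ### Green's relations and maximal subgroups -/

theorem WithOne.eq_one_or_eq_coe {α : Type*} (a : WithOne α) : a = 1 ∨ ∃ b : α, a = b :=
  or_iff_not_imp_left.2 fun h => (WithOne.ne_one_iff_exists.1 h).imp fun _ => Eq.symm

namespace InverseSemigroup

variable {S : Type*} [InverseSemigroup S]

/-- If `x` is a left multiple of `y` then `dom y` fixes `x` on the right, so `dom x` lies below `dom
y`. Conversely, equal domains give `x = x * y⁻¹ * y`. -/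
theorem greenL_iff {x y : S} : greenL S x y ↔ dom x = dom y := by
  have key : ∀ x y : S, (∃ a : WithOne S, (x : WithOne S) = a * y) →
      (dom x : S) * dom y = dom x := by
    rintro x y ⟨a, ha⟩
    have : x * dom y = x := by
      rcases WithOne.eq_one_or_eq_coe a with rfl | ⟨a, rfl⟩
      · rw [one_mul, WithOne.coe_inj] at ha
        rw [ha, mul_dom]
      · rw [← WithOne.coe_mul, WithOne.coe_inj] at ha
        rw [ha, mul_assoc, mul_dom]
    rw [coe_dom x, mul_assoc, this]
  change {z : S | _} = {z : S | _} ↔ _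
  constructor
  · intro h
    have h1 : ∃ a : WithOne S, (x : WithOne S) = a * y := by
      change x ∈ {z : S | ∃ a : WithOne S, (z : WithOne S) = a * y}
      rw [← h]
      exact ⟨1, (one_mul _).symm⟩
    have h2 : ∃ a : WithOne S, (y : WithOne S) = a * x := by
      change y ∈ {z : S | ∃ a : WithOne S, (z : WithOne S) = a * x}
      rw [h]
      exact ⟨1, (one_mul _).symm⟩
    apply Subtype.ext
    rw [← key x y h1, idem_comm (dom x).2 (dom y).2, key y x h2]
  · have hsub : ∀ x y : S, dom x = dom y → ∀ z : S, (∃ a : WithOne S, (z : WithOne S) = a * x) →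
        ∃ a : WithOne S, (z : WithOne S) = a * y := by
      rintro x y h z ⟨a, ha⟩
      refine ⟨a * (x * y⁻¹ : S), ?_⟩
      rw [mul_assoc, ← WithOne.coe_mul, mul_assoc, ← coe_dom, ← h, mul_dom, ha]
    intro h
    ext z
    exact ⟨hsub x y h z, hsub y x h.symm z⟩

theorem greenR_iff {x y : S} : greenR S x y ↔ ran x = ran y := by
  have key : ∀ x y : S, (∃ b : WithOne S, (x : WithOne S) = y * b) →
      (ran y : S) * ran x = ran x := by
    rintro x y ⟨a, ha⟩
    have : ran y * x = x := by
      rcases WithOne.eq_one_or_eq_coe a with rfl | ⟨a, rfl⟩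
      · rw [mul_one, WithOne.coe_inj] at ha
        rw [ha, ran_mul]
      · rw [← WithOne.coe_mul, WithOne.coe_inj] at ha
        rw [ha, ← mul_assoc, ran_mul]
    rw [coe_ran x, ← mul_assoc, this]
  change {z : S | _} = {z : S | _} ↔ _
  constructor
  · intro h
    have h1 : ∃ a : WithOne S, (x : WithOne S) = y * a := by
      change x ∈ {z : S | ∃ a : WithOne S, (z : WithOne S) = y * a}
      rw [← h]
      exact ⟨1, (mul_one _).symm⟩
    have h2 : ∃ a : WithOne S, (y : WithOne S) = x * a := by
      change y ∈ {z : S | ∃ a : WithOne S, (z : WithOne S) = x * a}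
      rw [h]
      exact ⟨1, (mul_one _).symm⟩
    apply Subtype.ext
    rw [← key x y h1, idem_comm (ran y).2 (ran x).2, key y x h2]
  · have hsub : ∀ x y : S, ran x = ran y → ∀ z : S, (∃ a : WithOne S, (z : WithOne S) = x * a) →
        ∃ a : WithOne S, (z : WithOne S) = y * a := by
      rintro x y h z ⟨a, ha⟩
      refine ⟨(y⁻¹ * x : S) * a, ?_⟩
      rw [← mul_assoc, ← WithOne.coe_mul, ← mul_assoc, ← coe_ran, ← h, ran_mul, ha]
    intro h
    ext z
    exact ⟨hsub x y h z, hsub y x h.symm z⟩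

theorem greenJ_of_mul_mul {x y a b c d : S} (h1 : x = a * y * b) (h2 : y = c * x * d) :
    greenJ S x y := by
  change {z : S | _} = {z : S | _}
  have hsub : ∀ x y a b : S, x = a * y * b → ∀ z : S,
      (∃ a b : WithOne S, (z : WithOne S) = a * x * b) →
        ∃ a b : WithOne S, (z : WithOne S) = a * y * b := by
    rintro x y a b h z ⟨p, q, hpq⟩
    refine ⟨p * a, b * q, ?_⟩
    rw [hpq, h]
    simp only [WithOne.coe_mul, mul_assoc]
  ext z
  exact ⟨hsub x y a b h1 z, hsub y x c d h2 z⟩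

/-- Since `y = ran y * y * dom y`, an adjoined identity among the multipliers can be absorbed into
`S`. -/
theorem exists_of_greenJ {x y : S} (h : greenJ S x y) : ∃ a b : S, x = a * y * b := by
  have h1 : x ∈ {z : S | ∃ a b : WithOne S, (z : WithOne S) = a * y * b} := by
    have h' : {z : S | ∃ a b : WithOne S, (z : WithOne S) = a * x * b} =
      {z : S | ∃ a b : WithOne S, (z : WithOne S) = a * y * b} := h
    rw [← h']
    exact ⟨1, 1, by rw [one_mul, mul_one]⟩
  have hy : (y : WithOne S) = (ran y : S) * (y : WithOne S) * (dom y : S) := by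
    rw [← WithOne.coe_mul, ran_mul, ← WithOne.coe_mul, mul_dom]
  obtain ⟨a, b, hab⟩ := h1
  have hA : ∀ (a : WithOne S) (e : S), ∃ a' : S, a * e = (a' : WithOne S) := by
    intro a e
    rcases WithOne.eq_one_or_eq_coe a with rfl | ⟨a, rfl⟩
    · exact ⟨e, one_mul _⟩
    · exact ⟨a * e, (WithOne.coe_mul _ _).symm⟩
  have hB : ∀ (a : WithOne S) (e : S), ∃ a' : S, e * a = (a' : WithOne S) := by
    intro a e
    rcases WithOne.eq_one_or_eq_coe a with rfl | ⟨a, rfl⟩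
    · exact ⟨e, mul_one _⟩
    · exact ⟨e * a, (WithOne.coe_mul _ _).symm⟩
  obtain ⟨a', ha⟩ := hA a (ran y)
  obtain ⟨b', hb⟩ := hB b (dom y)
  refine ⟨a', b', WithOne.coe_inj.1 ?_⟩
  rw [hab, WithOne.coe_mul, WithOne.coe_mul, ← ha, ← hb]
  conv_lhs => rw [hy]
  simp only [mul_assoc]

theorem greenJ_dom (x : S) : greenJ S x (dom x) :=
  greenJ_of_mul_mul (a := x) (b := dom x) (c := x⁻¹) (d := dom x)
    (by rw [mul_dom, mul_dom]) (by rw [mul_assoc, mul_dom, coe_dom])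

theorem greenJ_ran (x : S) : greenJ S x (ran x) :=
  greenJ_of_mul_mul (a := ran x) (b := x) (c := ran x) (d := x⁻¹)
    (by rw [(ran x).2, ran_mul]) (by rw [ran_mul, coe_ran])

theorem exists_ran_eq_of_eq_mul_mul {e f : Idem S} {a b : S} (h : (e : S) = a * f * b) :
    ∃ x : S, ran x = e ∧ (dom x : S) * f = dom x := by
  -- Its range is below `e`; and `e = (e * a * f) * (f * b * e)` puts `e` below that range.
  refine ⟨e * a * f, ?_, ?_⟩
  · have h1 : (e : S) * ran ((e : S) * a * f) = ran ((e : S) * a * f) := by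
      rw [coe_ran]
      simp only [← mul_assoc]
      rw [e.2]
    have h2 : (e : S) = e * a * f * (f * b * e) := by
      calc (e : S) = e * e * e := by rw [e.2, e.2]
        _ = e * (a * f * b) * e := by rw [← h]
        _ = e * (a * (f * f) * b) * e := by rw [f.2]
        _ = _ := by simp only [mul_assoc]
    apply Subtype.ext
    rw [← h1, idem_comm e.2 (ran _).2]
    conv_lhs => rw [← h1]
    conv_rhs => rw [h2, ← ran_mul ((e : S) * a * f), mul_assoc, ← h2]
    rw [h1, idem_comm (ran _).2 e.2, h1]
  · have := dom_mul_mul_dom ((e : S) * a) f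
    rwa [dom_idem] at this

/-- Here finiteness makes 𝓙 equal to 𝓓: each idempotent is linked to one below the other, so the
ranks agree, and an idempotent below `f` of the same rank is `f`. -/
theorem greenJ_idem_iff [Finite S] {e f : Idem S} :
    greenJ S e f ↔ ∃ x : S, ran x = e ∧ dom x = f := by
  constructor
  · intro h
    obtain ⟨a, b, hab⟩ := exists_of_greenJ h
    obtain ⟨c, d, hcd⟩ := exists_of_greenJ ((greenJ S).symm h)
    obtain ⟨x, hx, hx'⟩ := exists_ran_eq_of_eq_mul_mul hab
    obtain ⟨y, hy, hy'⟩ := exists_ran_eq_of_eq_mul_mul hcd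
    refine ⟨x, hx, eq_of_le_of_rank_le hx' ?_⟩
    rw [← rank_ran_eq_rank_dom x, hx, ← hy, rank_ran_eq_rank_dom y]
    exact rank_le_of_le hy'
  · rintro ⟨x, rfl, rfl⟩
    exact (greenJ S).trans ((greenJ S).symm (greenJ_ran x)) (greenJ_dom x)

/-- The classes of a setoid which are labelled by idempotents, counted inside a saturated set. -/
theorem ncard_classes_subset_eq (s : Setoid S) (p : S → Idem S) (hp : ∀ e : Idem S, p e = e)
    (hs : ∀ x y, s x y ↔ p x = p y) {J : Set S} (hJ : ∀ x, x ∈ J ↔ (p x : S) ∈ J) :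
    {L : Set S | L ∈ s.classes ∧ L ⊆ J}.ncard = {e : Idem S | (e : S) ∈ J}.ncard := by
  have himage : {L : Set S | L ∈ s.classes ∧ L ⊆ J} =
      (fun e : Idem S => {x : S | p x = e}) '' {e : Idem S | (e : S) ∈ J} := by
    ext L
    constructor
    · rintro ⟨⟨y, rfl⟩, hL⟩
      refine ⟨p y, (hJ y).1 (hL (s.refl y)), ?_⟩
      ext x
      exact (hs x y).symm
    · rintro ⟨e, he, rfl⟩
      refine ⟨⟨e, ?_⟩, ?_⟩
      · ext x
        change p x = e ↔ s x e
        rw [hs, hp]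
      · intro x hx
        rw [hJ, show p x = e from hx]
        exact he
  rw [himage, Set.ncard_image_of_injective]
  intro e f h
  have : (e : S) ∈ {x : S | p x = f} := by
    have h' : {x : S | p x = e} = {x : S | p x = f} := h
    rw [← h']
    exact hp e
  rw [← hp e]
  exact this

theorem mem_iff_of_mem_classes {α : Type*} {s : Setoid α} {J : Set α} (hJ : J ∈ s.classes)
    {x y : α} (h : s x y) : x ∈ J ↔ y ∈ J := by
  obtain ⟨z, rfl⟩ := hJ
  exact ⟨fun hx => s.trans (s.symm h) hx, fun hy => s.trans h hy⟩

theorem numLClasses_eq {J : Set S} (hJ : J ∈ (greenJ S).classes) :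
    numLClasses J = {e : Idem S | (e : S) ∈ J}.ncard :=
  ncard_classes_subset_eq _ dom dom_idem (fun _ _ => greenL_iff)
    fun x => mem_iff_of_mem_classes hJ (greenJ_dom x)

theorem numRClasses_eq {J : Set S} (hJ : J ∈ (greenJ S).classes) :
    numRClasses J = {e : Idem S | (e : S) ∈ J}.ncard :=
  ncard_classes_subset_eq _ ran ran_idem (fun _ _ => greenR_iff)
    fun x => mem_iff_of_mem_classes hJ (greenJ_ran x)

theorem isGroupSubsemigroup_groupAt (e : Idem S) : IsGroupSubsemigroup (groupAt e) :=
  ⟨e, self_mem_groupAt e,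
    fun _ hx => ⟨idem_mul_of_mem_groupAt hx, mul_idem_of_mem_groupAt hx⟩,
    fun x hx => ⟨x⁻¹, inv_mem_groupAt hx, mul_inv_of_mem_groupAt hx, inv_mul_of_mem_groupAt hx⟩⟩

/-- A group inverse is a generalized inverse, hence equals `x⁻¹`; so the group lies in the vertex
group at its identity, and maximality gives equality. -/
theorem exists_eq_groupAt (G : MaximalSubgroup S) : ∃ e : Idem S, G.toSubsemigroup = groupAt e := by
  obtain ⟨e, he, hid, hinv⟩ := G.maximal.prop
  refine ⟨⟨e, (hid e he).1⟩, G.maximal.eq_of_le (isGroupSubsemigroup_groupAt _) fun x hx => ?_⟩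
  obtain ⟨y, hy, hxy, hyx⟩ := hinv x hx
  have hyinv : y = x⁻¹ := eq_inv x y (by rw [hxy, (hid x hx).1]) (by rw [hyx, (hid y hy).1])
  exact ⟨Subtype.ext (by rw [coe_ran, ← hyinv, hxy]), Subtype.ext (by rw [coe_dom, ← hyinv, hyx])⟩

theorem subsemigroupChainNum_groupAt_eq [Finite S] {e f : Idem S} (h : greenJ S e f) :
    subsemigroupChainNum (groupAt e) = subsemigroupChainNum (groupAt f) := by
  obtain ⟨x, rfl, rfl⟩ := greenJ_idem_iff.1 h
  exact (subsemigroupChainNum_congr (groupAtEquiv x)).symm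

theorem rel_of_mem_classes {α : Type*} {s : Setoid α} {J : Set α} (hJ : J ∈ s.classes)
    {x y : α} (hx : x ∈ J) (hy : y ∈ J) : s x y := by
  obtain ⟨z, rfl⟩ := hJ
  exact s.trans hx (s.symm hy)

/-- The sum over idempotents is split by 𝓙-class. Vertex groups in one class are conjugate, so they
share the chain number of the chosen maximal subgroup. -/
theorem inverseSubsemigroupChainNum_eq_sum_greenJ [Finite S] (m : ℕ)
    (J : Fin m ≃ {J : Set S // J ∈ (greenJ S).classes})
    (G : Fin m → MaximalSubgroup S)
    (hG : ∀ i, ((G i).toSubsemigroup : Set S) ⊆ (J i : Set S)) :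
    inverseSubsemigroupChainNum S + m =
      ∑ i, (numLClasses (J i : Set S) * subsemigroupChainNum (G i).toSubsemigroup +
        numLClasses (J i : Set S)) := by
  classical
  let : Fintype (Idem S) := Fintype.ofFinite _
  let p : Idem S → Fin m := fun e => J.symm ⟨{x | greenJ S x e}, Setoid.mem_classes _ _⟩
  have hpJ : ∀ e i, p e = i ↔ (e : S) ∈ (J i : Set S) := by
    intro e i
    rw [Equiv.symm_apply_eq]
    constructor
    · intro h
      rw [← h]
      exact (greenJ S).refl e
    · intro h
      apply Subtype.ext
      ext x
      exact ⟨fun hx => (mem_iff_of_mem_classes (J i).2 hx).2 h,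
        fun hx => rel_of_mem_classes (J i).2 hx h⟩
  choose c hc using fun i => exists_eq_groupAt (G i)
  have hcJ : ∀ i, (c i : S) ∈ (J i : Set S) := fun i => hG i (by
    rw [hc i]
    exact self_mem_groupAt (c i))
  have key := inverseSubsemigroupChainNum_add_card p (fun i => ⟨c i, (hpJ _ _).2 (hcJ i)⟩)
    fun e f => by
      rw [hpJ, ← greenJ_idem_iff]
      constructor
      · exact fun h => rel_of_mem_classes (J (p f)).2 h ((hpJ _ _).1 rfl)
      · exact fun h => (mem_iff_of_mem_classes (J (p f)).2 h).2 ((hpJ _ _).1 rfl)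
  have hnum : ∀ i, numLClasses (J i : Set S) = (Finset.univ.filter fun e => p e = i).card := by
    intro i
    rw [numLClasses_eq (J i).2, ← Set.ncard_coe_finset]
    congr 1
    ext e
    simp [hpJ]
  rw [Fintype.card_fin] at key
  rw [key, Finset.sum_add_distrib, ← Finset.sum_fiberwise Finset.univ p]
  congr 1
  · refine Finset.sum_congr rfl fun i _ => ?_
    rw [hnum, ← smul_eq_mul, ← Finset.sum_const, hc i]
    refine Finset.sum_congr rfl fun e he => subsemigroupChainNum_groupAt_eq ?_
    exact rel_of_mem_classes (J i).2 ((hpJ _ _).1 (Finset.mem_filter.1 he).2) (hcJ i)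
  · rw [Finset.sum_congr rfl fun i _ => hnum i, ← Finset.card_univ]
    exact Finset.card_eq_sum_card_fiberwise fun _ _ => Finset.mem_coe.2 (Finset.mem_univ _)

end InverseSemigroup

/-! ### The length formula -/

open InverseSemigroup in
theorem mainTheorem7 {S : Type*} [Semigroup S] [Finite S] (hS : IsInverseSemigroup S)
    (m : ℕ) (J : Fin m ≃ {J : Set S // J ∈ (greenJ S).classes})
    (G : Fin m → MaximalSubgroup S)
    (hG : ∀ i, ((G i).toSubsemigroup : Set S) ⊆ (J i : Set S))
    (n : Fin m → ℕ) (hn : ∀ i, n i = numLClasses (J i : Set S)) :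
    (∀ i, n i = numRClasses (J i : Set S)) ∧
    inverseSubsemigroupLength S =
      -1 + ∑ i, inverseSubsemigroupLength (BrandtSemigroup (G i).toSubsemigroup (n i)) ∧
    inverseSubsemigroupLength S =
      -1 + ∑ i, ((n i : ℤ) * (subsemigroupLength (G i).toSubsemigroup + 1) + n i - 1) := by
  let : InverseSemigroup S := hS.toInverseSemigroup
  have hn0 : ∀ i, n i ≠ 0 := fun i => by
    obtain ⟨e, he⟩ := exists_eq_groupAt (G i)
    rw [hn, numLClasses_eq (J i).2]
    exact ((Set.ncard_pos (Set.toFinite _)).2 ⟨e, hG i (by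
      rw [he]
      exact self_mem_groupAt e)⟩).ne'
  have hmain : inverseSubsemigroupLength S =
      -1 + ∑ i, ((n i : ℤ) * (subsemigroupLength (G i).toSubsemigroup + 1) + n i - 1) := by
    -- The `m` on the left becomes the -1 in each summand; the leading -1 converts the number of
    -- members into a length.
    have key := inverseSubsemigroupChainNum_eq_sum_greenJ m J G hG
    simp only [← hn] at key
    zify at key
    simp only [subsemigroupLength_eq, inverseSubsemigroupLength_eq, sub_add_cancel,
      Finset.sum_sub_distrib, Finset.sum_const, Finset.card_univ, Fintype.card_fin]
    rw [← key]
    simp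
    ring
  refine ⟨fun i => ?_, ?_, hmain⟩
  · rw [hn, numLClasses_eq (J i).2, numRClasses_eq (J i).2]
  · rw [hmain]
    congr 1
    exact Finset.sum_congr rfl fun i _ =>
      (BrandtSemigroup.inverseSubsemigroupLength_eq (hn0 i)).symm
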